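/- Notation. An ideal on $\omega$ is a family $J\subseteq\mathcal P(\omega)$ closed under subsets and finite unions that contains all finite subsets of $\omega$ and does not contain $\omega$; $\mathrm{Fin}$ is the ideal of finite sets, $J^{\mathrm d}=\{\omega\smallsetminus a: a\in J\}$ and $J^+=\mathcal P(\omega)\smallsetminus J$. $J$ has the Baire property if it does as a subset of the Cantor space $\mathcal P(\omega)\cong{}^\omega\{0,1\}$. A relational system $\mathbf R=\langle X,Y,\sqsubset\rangle$ consists of two non-empty sets and a relation; $\mathfrak b(\mathbf R)$ is the least size of a set $F\subseteq X$ for which there is no $y\in Y$ with $x\sqsubset y$ for all $x\in F$, and $\mathfrak d(\mathbf R)$ is the least size of a set $D\subseteq Y$ such that every $x\in X$ satisfies $x\sqsubset y$ for some $y\in D$ (with value $\infty$ if there is no such set). We write $\langle X,Y,\sqsubset\rangle\le_{\mathrm T}\langle X',Y',\sqsubset'\rangle$ if there are maps $\Psi_-\colon X\to X'$ and $\Psi_+\colon Y'\to Y$ such that $\Psi_-(x)\sqsubset' y'$ implies $x\sqsubset\Psi_+(y')$ for all $x\in X$, $y'\in Y'$; and $\mathbf R\cong_{\mathrm T}\mathbf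 R'$ if $\mathbf R\le_{\mathrm T}\mathbf R'$ and $\mathbf R'\le_{\mathrm T}\mathbf R$. For $h\in{}^\omega\omega$ let $\mathcal S(h)=\prod_{n\in\omega}[\omega]^{\le h(n)}$, and let $$\mathbf{Lc}_J(h)=\langle{}^\omega\omega,\mathcal S(h),\in^{J^{\mathrm d}}\rangle,\qquad \mathbf{pLc}_J(h)=\langle{}^\omega\omega,\mathcal S(h),\in^{J^+}\rangle,$$ where $x\in^A s$ means $\{n\in\omega: x(n)\in s(n)\}\in A$. Put $\mathfrak{sl}_{\mathrm t}(h,J)=\mathfrak d(\mathbf{Lc}_J(h))$, $\mathfrak{sl}_{\mathrm e}(h,J)=\mathfrak d(\mathbf{pLc}_J(h))$, $\mathfrak{sl}_{\mathrm t}^\perp(h,J)=\mathfrak b(\mathbf{Lc}_J(h))$, $\mathfrak{sl}_{\mathrm e}^\perp(h,J)=\mathfrak b(\mathbf{pLc}_J(h))$. Finally, $\mathcal M$ and $\mathcal N$ are the ideals of meager and of Lebesgue null subsets of $\mathbb R$, with their usual cardinal invariants $\mathrm{add}$, $\mathrm{cov}$, $\mathrm{non}$, $\mathrm{cof}$, and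 $\mathcal N$ is also regarded as the relational system $\langle\mathcal N,\mathcal N,\subseteq\rangle$. Theorem. Let $J$ be an ideal on $\omega$ with the Baire property and let $h,g\in{}^\omega\omega$ be such that $h(n)\ge 1$ for all but finitely many $n$ and $\lim_{n\to\infty}g(n)=\infty$. Then $\mathbf{pLc}_J(h)\cong_{\mathrm T}\mathbf{pLc}_{\mathrm{Fin}}(1)$, where $1$ is the constant function, and $\mathbf{Lc}_J(g)\cong_{\mathrm T}\mathcal N$. In particular, $\mathfrak{sl}_{\mathrm e}(h,J)=\mathrm{non}(\mathcal M)$, $\mathfrak{sl}_{\mathrm t}(g,J)=\mathrm{cof}(\mathcal N)$, $\mathfrak{sl}_{\mathrm t}^\perp(g,J)=\mathrm{add}(\mathcal N)$ and $\mathfrak{sl}_{\mathrm e}^\perp(h,J)=\mathrm{cov}(\mathcal M)$. -/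

import Mathlib

open Filter MeasureTheory Cardinal

universe u

namespace Slalom

/-- A relational system: two non-empty sets and a relation between them. -/
structure RelSystem : Type (u + 1) where
  X : Type u
  Y : Type u
  rel : X → Y → Prop
  nonempty_X : Nonempty X
  nonempty_Y : Nonempty Y

/-- The least cardinality of a subset of `α` with property `P`; it is `⊤` (that is, `∞`,
"undefined") when no subset of `α` has the property. -/
noncomputable def minCard {α : Type u} (P : Set α → Prop) : WithTop Cardinal.{u} :=
  ⨅ D : {D : Set α // P D}, ((#(D : Set α) : Cardinal.{u}) : WithTop Cardinal.{u})

namespace RelSystem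

/-- `F ⊆ X` is bounded if a single `y` satisfies `x ⊏ y` for all `x ∈ F`. -/
def Bounded (R : RelSystem.{u}) (F : Set R.X) : Prop := ∃ y : R.Y, ∀ x ∈ F, R.rel x y

/-- `D ⊆ Y` is dominating if every `x` satisfies `x ⊏ y` for some `y ∈ D`. -/
def Dominating (R : RelSystem.{u}) (D : Set R.Y) : Prop := ∀ x : R.X, ∃ y ∈ D, R.rel x y

/-- The unbounding number `𝔟(R)`. -/
noncomputable def unboundingNumber (R : RelSystem.{u}) : WithTop Cardinal.{u} :=
  minCard fun F : Set R.X => ¬ R.Bounded F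

/-- The dominating number `𝔡(R)`. -/
noncomputable def dominatingNumber (R : RelSystem.{u}) : WithTop Cardinal.{u} :=
  minCard fun D : Set R.Y => R.Dominating D

/-- The Tukey order: there is a Tukey connection `(Ψ₋, Ψ₊)` from `R` into `R'`. -/
def TukeyLE (R R' : RelSystem.{u}) : Prop :=
  ∃ (Ψm : R.X → R'.X) (Ψp : R'.Y → R.Y),
    ∀ (x : R.X) (y' : R'.Y), R'.rel (Ψm x) y' → R.rel x (Ψp y')

/-- Tukey equivalence. -/
def TukeyEquiv (R R' : RelSystem.{u}) : Prop := R.TukeyLE R' ∧ R'.TukeyLE R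

end RelSystem

/-- Ideals on a set `M`: families closed under subsets and finite unions that contain all finite
subsets of `M` but not `M` itself. -/
structure IsIdealOn {M : Type u} (J : Set (Set M)) : Prop where
  mono : ∀ a b : Set M, a ⊆ b → b ∈ J → a ∈ J
  union : ∀ a b : Set M, a ∈ J → b ∈ J → a ∪ b ∈ J
  finite : ∀ a : Set M, a.Finite → a ∈ J
  univ_not_mem : Set.univ ∉ J

/-- The ideal of finite sets of natural numbers. -/
def Fin : Set (Set ℕ) := {a | a.Finite}

/-- The dual filter `Jᵈ` of `J`. -/
def dualFilter (J : Set (Set ℕ)) : Set (Set ℕ) := {a | aᶜ ∈ J}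

/-- The family `J⁺` of `J`-positive sets. -/
def positive (J : Set (Set ℕ)) : Set (Set ℕ) := {a | a ∉ J}

/-- The Baire property of a family of subsets of `ω`, seen through characteristic functions as a
subset of the Cantor space `ω → {0,1}` (product of discrete spaces). -/
def HasBaireProperty (J : Set (Set ℕ)) : Prop :=
  BaireMeasurableSet {χ : ℕ → Bool | {n : ℕ | χ n = true} ∈ J}

/-- The set `𝒮(h) = ∏ₙ [ω]^{≤ h(n)}` of `h`-slaloms. -/
def Slaloms (h : ℕ → ℕ) : Set (ℕ → Set ℕ) := {s | ∀ n : ℕ, (s n).encard ≤ h n}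

theorem Slaloms.nonempty (h : ℕ → ℕ) : Nonempty (Slaloms h) :=
  ⟨⟨fun _ => ∅, fun n => by simp⟩⟩

/-- The relational system `⟨ω^ω, 𝒮(h), ∈^A⟩`, where `x ∈^A s` iff `{n | x(n) ∈ s(n)} ∈ A`. -/
def slalomSystem (A : Set (Set ℕ)) (h : ℕ → ℕ) : RelSystem.{0} where
  X := ℕ → ℕ
  Y := Slaloms h
  rel := fun x s => {n : ℕ | x n ∈ (s : ℕ → Set ℕ) n} ∈ A
  nonempty_X := ⟨fun _ => 0⟩
  nonempty_Y := Slaloms.nonempty h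

/-- Localization modulo `J`. -/
def Lc (J : Set (Set ℕ)) (h : ℕ → ℕ) : RelSystem.{0} := slalomSystem (dualFilter J) h

/-- Pseudo-localization modulo `J`. -/
def pLc (J : Set (Set ℕ)) (h : ℕ → ℕ) : RelSystem.{0} := slalomSystem (positive J) h

/-- The slalom number `𝔰𝔩_t(h, J)`. -/
noncomputable def slT (h : ℕ → ℕ) (J : Set (Set ℕ)) : WithTop Cardinal.{0} :=
  (Lc J h).dominatingNumber

/-- The slalom number `𝔰𝔩_e(h, J)`. -/
noncomputable def slE (h : ℕ → ℕ) (J : Set (Set ℕ)) : WithTop Cardinal.{0} :=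
  (pLc J h).dominatingNumber

/-- The dual slalom number `𝔰𝔩_t^⊥(h, J)`. -/
noncomputable def slTPerp (h : ℕ → ℕ) (J : Set (Set ℕ)) : WithTop Cardinal.{0} :=
  (Lc J h).unboundingNumber

/-- The dual slalom number `𝔰𝔩_e^⊥(h, J)`. -/
noncomputable def slEPerp (h : ℕ → ℕ) (J : Set (Set ℕ)) : WithTop Cardinal.{0} :=
  (pLc J h).unboundingNumber

/-- The additivity of a family `I` of subsets of `M`. -/
noncomputable def add {M : Type u} (I : Set (Set M)) : WithTop Cardinal.{u} :=
  minCard fun F : Set (Set M) => F ⊆ I ∧ ⋃₀ F ∉ I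

/-- The cofinality of `I`. -/
noncomputable def cof {M : Type u} (I : Set (Set M)) : WithTop Cardinal.{u} :=
  minCard fun F : Set (Set M) => F ⊆ I ∧ ∀ a ∈ I, ∃ b ∈ F, a ⊆ b

/-- The covering number of `I`. -/
noncomputable def cov {M : Type u} (I : Set (Set M)) : WithTop Cardinal.{u} :=
  minCard fun F : Set (Set M) => F ⊆ I ∧ ⋃₀ F = Set.univ

/-- The uniformity of `I`. -/
noncomputable def non {M : Type u} (I : Set (Set M)) : WithTop Cardinal.{u} :=
  minCard fun a : Set M => a ∉ I

/-- A non-empty family `I` as the relational system `⟨I, I, ⊆⟩`. -/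
def inclusionSystem {M : Type u} (I : Set (Set M)) (hI : I.Nonempty) : RelSystem.{u} where
  X := I
  Y := I
  rel := fun a b => (a : Set M) ⊆ (b : Set M)
  nonempty_X := hI.to_subtype
  nonempty_Y := hI.to_subtype

/-- The ideal `ℳ` of meager sets of reals. -/
def meager : Set (Set ℝ) := {a | IsMeagre a}

/-- The ideal `𝒩` of Lebesgue null sets of reals. -/
def null : Set (Set ℝ) := {a | volume a = 0}

theorem null_nonempty : null.Nonempty := ⟨∅, by simp [null]⟩

end Slalom

/-! The Baire property enters only through a partition of `ℕ` into finite intervals such that no set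
in `J` contains infinitely many of them (`IsIdealOn.exists_partition`). This makes `J` behave like
`Fin` after coding: a function can be replaced by one whose values code its initial segments up to
the end of each interval, or be spread out constantly over the intervals.

For pseudo-localization, a correct guess of a code at `n` gives correct values on the whole `n`-th
interval, so infinitely many correct guesses yield a `J`-positive set of correct values
(`IsIdealOn.pLc_one_tukeyLE`). Conversely, `J`-positive sets are infinite, and the width of the
slalom does not matter modulo `Fin` (`pLc_Fin_one_tukeyLE_of_forall`).

For localization there is a cycle of reductions `Lc J g` ≤ `Lc Fin g` ≤ `Lc Fin f` ≤ `null` ≤ `Lc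
Fin g'` ≤ `Lc J g`, with `f` and `g'` suitable widths. The second step is where `g → ∞` is used; the
last takes unions of a slalom over intervals. The two steps through `null` are Bartoszyński's
theorem: Borel–Cantelli in one direction, independent sets and the Baire category theorem in the
other.

The equalities for `null` then follow from Tukey equivalence. Those for `meager` use Bartoszyński's
characterization by infinitely often equal functions. There, evading a meager set takes two
successive guesses (`exists_evading_meagre`), so the argument compares cardinals instead of giving a
Tukey connection. -/

namespace Slalom

/-! ### Coding initial segments -/

/-- A natural number coding the first `N` values of `x`. -/
def initCode (x : ℕ → ℕ) (N : ℕ) : ℕ := Encodable.encode ((List.range N).map x)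

/-- The `m`-th value of the finite sequence coded by `c`, and `0` beyond its length. -/
def evalCode (c m : ℕ) : ℕ := (((Encodable.decode c : Option (List ℕ)).getD [])[m]?).getD 0

theorem evalCode_initCode (x : ℕ → ℕ) (N m : ℕ) :
    evalCode (initCode x N) m = if m < N then x m else 0 := by
  simp only [evalCode, initCode, Encodable.encodek, Option.getD_some]
  split_ifs with h <;> simp [h]

theorem evalCode_initCode_of_lt (x : ℕ → ℕ) {N m : ℕ} (h : m < N) :
    evalCode (initCode x N) m = x m := by
  rw [evalCode_initCode, if_pos h]

theorem finite_support_evalCode (c : ℕ) : {m | evalCode c m ≠ 0}.Finite := by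
  refine (Set.finite_lt_nat
    ((Encodable.decode c : Option (List ℕ)).getD []).length).subset fun m hm => ?_
  by_contra h
  exact hm (by rw [evalCode, List.getElem?_eq_none (not_lt.1 h), Option.getD_none])

/-- A strictly increasing sequence cuts `ℕ` into intervals; there is a function sending each point
to the index of its interval. -/
theorem exists_blockIndex {i : ℕ → ℕ} (hi : StrictMono i) :
    ∃ b : ℕ → ℕ, ∀ n m, i n ≤ m → m < i (n + 1) → b m = n := by
  refine ⟨fun m => Nat.findGreatest (fun n => i n ≤ m) m, fun n m h1 h2 => ?_⟩
  rw [Nat.findGreatest_eq_iff]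
  refine ⟨(hi.id_le n).trans h1, fun _ => h1, fun k hk _ h => ?_⟩
  exact absurd (h2.trans_le (hi.monotone hk)) (not_lt.2 h)

theorem exists_block {i : ℕ → ℕ} (hi : StrictMono i) {m : ℕ} (h : i 0 ≤ m) :
    ∃ n, i n ≤ m ∧ m < i (n + 1) := by
  have hex : ∃ k, m < i k := ⟨m + 1, (Nat.lt_succ_self m).trans_le (hi.id_le _)⟩
  obtain ⟨k, hk, hk'⟩ : ∃ k, m < i k ∧ ∀ l < k, i l ≤ m :=
    ⟨Nat.find hex, Nat.find_spec hex, fun l hl => not_lt.1 (Nat.find_min hex hl)⟩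
  cases k with
  | zero => omega
  | succ n => exact ⟨n, hk' n n.lt_succ_self, hk⟩

/-! ### Meager sets of sequences -/

theorem exists_cylinder_subset {α : Type*} [TopologicalSpace α] {U : Set (ℕ → α)} (hU : IsOpen U) {z : ℕ → α} (hz : z ∈ U) :
    ∃ N, ∀ y : ℕ → α, (∀ m < N, y m = z m) → y ∈ U := by
  obtain ⟨I, u, h1, h2⟩ := isOpen_pi_iff.1 hU z hz
  refine ⟨I.sup id + 1, fun y hy => h2 fun m hm => ?_⟩
  rw [hy m (Nat.lt_succ_of_le (Finset.le_sup (f := id) hm))]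
  exact (h1 m hm).2

section Cantor

variable {α : Type*} [TopologicalSpace α] [DiscreteTopology α]

theorem isOpen_cylinder (z : ℕ → α) (s : Set ℕ) (hs : s.Finite) :
    IsOpen {y : ℕ → α | ∀ m ∈ s, y m = z m} := by
  have : {y : ℕ → α | ∀ m ∈ s, y m = z m} = s.pi fun m => {z m} := by ext; simp [Set.mem_pi]
  rw [this]
  exact isOpen_set_pi hs fun _ _ => isOpen_discrete _

/-- One block can be chosen so as to leave a nowhere dense set whatever came before. -/
theorem exists_block_avoiding [Finite α] [Nonempty α] {F : Set (ℕ → α)} (hF : IsNowhereDense F)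
    (i : ℕ) :
    ∃ j > i, ∃ w : ℕ → α, ∀ y : ℕ → α, (∀ m, i ≤ m → m < j → y m = w m) → y ∉ F := by
  classical
  -- The initial pieces of length `i` are treated one at a time, each lengthening the word `w`.
  -- Finiteness of `α` leaves only finitely many of them.
  have key : ∀ T : Finset (_root_.Fin i → α), ∃ j > i, ∃ w : ℕ → α, ∀ z ∈ T, ∀ y : ℕ → α,
      (∀ m : _root_.Fin i, y m = z m) → (∀ m, i ≤ m → m < j → y m = w m) → y ∉ F := by
    intro T
    induction T using Finset.induction_on with
    | empty => exact ⟨i + 1, by simp, fun _ => Classical.arbitrary α, by simp⟩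
    | insert z T _ ih =>
      obtain ⟨j, hj, w, hw⟩ := ih
      let v : ℕ → α := fun m => if h : m < i then z ⟨m, h⟩ else w m
      have hV := isOpen_cylinder v (Set.Iio j) (Set.finite_Iio j)
      have hd : Dense (closure F)ᶜ := interior_eq_empty_iff_dense_compl.1 hF
      obtain ⟨y₀, h₁, h₂⟩ := hd.inter_open_nonempty _ hV ⟨v, fun _ _ => rfl⟩
      obtain ⟨N, hN⟩ := exists_cylinder_subset isClosed_closure.isOpen_compl h₂
      refine ⟨max j N, lt_max_of_lt_left hj, y₀, fun z' hz' y hy1 hy2 => ?_⟩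
      rcases Finset.mem_insert.1 hz' with rfl | hz'
      · refine fun hyF => hN y (fun m hm => ?_) (subset_closure hyF)
        by_cases hmi : m < i
        · have := h₁ m (hmi.trans hj)
          rw [this, hy1 ⟨m, hmi⟩]
          simp [v, hmi]
        · exact hy2 m (not_lt.1 hmi) (lt_max_of_lt_right hm)
      · refine hw z' hz' y hy1 fun m hm1 hm2 => ?_
        rw [hy2 m hm1 (lt_max_of_lt_left hm2), h₁ m hm2]
        simp [v, hm1]
  have : Fintype α := Fintype.ofFinite α
  obtain ⟨j, hj, w, hw⟩ := key Finset.univ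
  exact ⟨j, hj, w, fun y hy => hw (fun m => y m) (Finset.mem_univ _) y (fun _ => rfl) hy⟩

/-- Every meager set of sequences is contained in the set of those `y` that differ from a fixed `x`
on almost all intervals of an interval partition. -/
theorem exists_chopped_of_isMeagre [Finite α] [Nonempty α] {A : Set (ℕ → α)} (hA : IsMeagre A) :
    ∃ (i : ℕ → ℕ) (x : ℕ → α), StrictMono i ∧ ∀ y : ℕ → α,
      (∃ᶠ n in atTop, ∀ m, i n ≤ m → m < i (n + 1) → y m = x m) → y ∉ A := by
  obtain ⟨S, hS1, hS2, hS3⟩ := isMeagre_iff_countable_union_isNowhereDense.1 hA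
  obtain ⟨E, hE⟩ : ∃ E : ℕ → Set (ℕ → α), insert ∅ S = Set.range E :=
    (hS2.insert ∅).exists_eq_range (Set.insert_nonempty _ _)
  have hEn : ∀ n, IsNowhereDense (E n) := by
    intro n
    have : E n ∈ insert ∅ S := hE ▸ Set.mem_range_self n
    rcases this with h | h
    · rw [h]; exact isNowhereDense_empty
    · exact hS1 _ h
  have hG : ∀ n, IsNowhereDense (⋃ k ∈ Finset.range n, E k) := by
    intro n
    induction n with
    | zero => simp
    | succ n ih =>
      rw [Finset.range_add_one, Finset.set_biUnion_insert]
      rw [IsNowhereDense, closure_union,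
        interior_union_isClosed_of_interior_empty isClosed_closure ih]
      exact hEn n
  choose nx hnx w hw using fun n i => exists_block_avoiding (hG n) i
  let i : ℕ → ℕ := fun n => Nat.rec 0 (fun n i => nx n i) n
  have hi : StrictMono i := strictMono_nat_of_lt_succ fun n => hnx n (i n)
  obtain ⟨b, hb⟩ := exists_blockIndex hi
  -- On the `n`-th interval `x` is the word avoiding the first `n` nowhere dense sets, so infinitely
  -- many agreements avoid them all.
  refine ⟨i, fun m => w (b m) (i (b m)) m, hi, fun y hy hyA => ?_⟩
  obtain ⟨s, hs, hys⟩ := hS3 hyA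
  obtain ⟨k, hk⟩ : s ∈ Set.range E := hE ▸ Set.mem_insert_of_mem _ hs
  obtain ⟨n, hn, hn'⟩ := (frequently_atTop.1 hy) (k + 1)
  refine hw n (i n) y (fun m h1 h2 => ?_)
    (Set.mem_biUnion (Finset.mem_coe.2 (Finset.mem_range.2 hn)) (hk ▸ hys))
  have := hn' m h1 h2
  simpa only [hb n m h1 h2] using this

end Cantor

/-! ### Ideals with the Baire property -/

/-- The homeomorphism of the Cantor space that flips all values from `N` on. -/
def flipTail (N : ℕ) : (ℕ → Bool) ≃ₜ (ℕ → Bool) where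
  toFun χ n := if n < N then χ n else !χ n
  invFun χ n := if n < N then χ n else !χ n
  left_inv χ := by ext n; by_cases h : n < N <;> simp [h]
  right_inv χ := by ext n; by_cases h : n < N <;> simp [h]
  continuous_toFun := continuous_pi fun n => by
    by_cases h : n < N
    · simpa [h] using continuous_apply n
    · simpa [h, Function.comp_def] using (continuous_of_discreteTopology (f := fun c : Bool => !c)).comp
        (continuous_apply n)
  continuous_invFun := continuous_pi fun n => by
    by_cases h : n < N
    · simpa [h] using continuous_apply n
    · simpa [h, Function.comp_def] using (continuous_of_discreteTopology (f := fun c : Bool => !c)).comp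
        (continuous_apply n)

/-- Otherwise `J` is comeager in some cylinder. Flipping the tail preserves the cylinder and
category, so some set and its tail complement are both in `J`; their union is cofinite. -/
theorem IsIdealOn.isMeagre {J : Set (Set ℕ)} (hJ : IsIdealOn J) (hB : HasBaireProperty J) :
    IsMeagre {χ : ℕ → Bool | {n : ℕ | χ n = true} ∈ J} := by
  obtain ⟨U, hU, hJU⟩ := BaireMeasurableSet.residualEq_isOpen hB
  set S := {χ : ℕ → Bool | {n : ℕ | χ n = true} ∈ J} with hS
  rcases U.eq_empty_or_nonempty with rfl | ⟨z, hz⟩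
  · filter_upwards [hJU] with χ hχ h
    exact (iff_of_eq hχ).1 h
  exfalso
  obtain ⟨N, hN⟩ := exists_cylinder_subset hU hz
  have hR : {χ | χ ∈ S ↔ χ ∈ U} ∈ residual (ℕ → Bool) := by
    filter_upwards [hJU] with χ hχ using iff_of_eq hχ
  have hR' : flipTail N ⁻¹' {χ | χ ∈ S ↔ χ ∈ U} ∈ residual (ℕ → Bool) := by
    have h : IsMeagre ({χ | χ ∈ S ↔ χ ∈ U}ᶜ) := by rwa [IsMeagre, compl_compl]
    have := h.preimage_of_isOpenMap (flipTail N).continuous (flipTail N).isOpenMap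
    rwa [IsMeagre, ← Set.preimage_compl, compl_compl] at this
  obtain ⟨χ, hχ, h1, h2⟩ := (dense_of_mem_residual (inter_mem hR hR')).inter_open_nonempty _
    (isOpen_cylinder z (Set.Iio N) (Set.finite_Iio N)) ⟨z, fun _ _ => rfl⟩
  have m1 : χ ∈ S := h1.2 (hN χ fun m hm => hχ m hm)
  have m2 : flipTail N χ ∈ S := h2.2 (hN _ fun m hm => by simpa [flipTail, hm] using hχ m hm)
  refine hJ.univ_not_mem (hJ.mono _ _ (fun n _ => ?_)
    (hJ.union _ _ (hJ.union _ _ m1 m2) (hJ.finite _ (Set.finite_Iio N))))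
  by_cases hn : n < N
  · exact Or.inr hn
  · left
    cases h : χ n
    · exact Or.inr (by simp [flipTail, hn, h])
    · exact Or.inl h

/-- An ideal with the Baire property admits an interval partition such that no set in the ideal
contains infinitely many of the intervals. -/
theorem IsIdealOn.exists_partition {J : Set (Set ℕ)} (hJ : IsIdealOn J)
    (hB : HasBaireProperty J) :
    ∃ i : ℕ → ℕ, StrictMono i ∧ ∀ a : Set ℕ,
      (∃ᶠ n in atTop, ∀ m, i n ≤ m → m < i (n + 1) → m ∈ a) → a ∉ J := by
  classical
  obtain ⟨i, x, hi, h⟩ := exists_chopped_of_isMeagre (hJ.isMeagre hB)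
  -- The part of `x` inside `a` agrees with `x` on every interval contained in `a`, yet it is a
  -- subset of `a`.
  refine ⟨i, hi, fun a ha haJ => h (fun m => decide (m ∈ a) && x m) ?_ ?_⟩
  · exact ha.mono fun n hn m h1 h2 => by simp [hn m h1 h2]
  · exact hJ.mono _ _ (fun m hm => by simp at hm; exact hm.1) haJ

/-! ### The Tukey order and cardinal invariants -/

theorem minCard_le {α : Type u} {P : Set α → Prop} {D : Set α} (h : P D) :
    minCard P ≤ ((#D : Cardinal.{u}) : WithTop Cardinal.{u}) :=
  iInf_le (fun D : {D : Set α // P D} => ((#(D : Set α) : Cardinal.{u}) : WithTop Cardinal.{u}))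
    ⟨D, h⟩

theorem minCard_le_minCard {α β : Type u} {P : Set α → Prop} {Q : Set β → Prop}
    (h : ∀ E, Q E → ∃ D, P D ∧ #D ≤ #E) : minCard P ≤ minCard Q := by
  refine le_iInf fun E => ?_
  obtain ⟨D, hD, hle⟩ := h E.1 E.2
  exact (minCard_le hD).trans (WithTop.coe_le_coe.2 hle)

namespace RelSystem

variable {R R' R'' : RelSystem.{u}}

theorem TukeyLE.trans (h : R.TukeyLE R') (h' : R'.TukeyLE R'') : R.TukeyLE R'' := by
  obtain ⟨a, b, hab⟩ := h
  obtain ⟨c, d, hcd⟩ := h'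
  exact ⟨c ∘ a, b ∘ d, fun x y hxy => hab _ _ (hcd _ _ hxy)⟩

theorem TukeyLE.dominatingNumber_le (h : R.TukeyLE R') :
    R.dominatingNumber ≤ R'.dominatingNumber := by
  obtain ⟨a, b, hab⟩ := h
  refine minCard_le_minCard fun E hE => ⟨b '' E, fun x => ?_, mk_image_le⟩
  obtain ⟨y, hy, hxy⟩ := hE (a x)
  exact ⟨b y, Set.mem_image_of_mem _ hy, hab _ _ hxy⟩

theorem TukeyLE.unboundingNumber_le (h : R.TukeyLE R') :
    R'.unboundingNumber ≤ R.unboundingNumber := by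
  obtain ⟨a, b, hab⟩ := h
  refine minCard_le_minCard fun F hF => ⟨a '' F, fun ⟨y, hy⟩ => hF ⟨b y, fun x hx => ?_⟩,
    mk_image_le⟩
  exact hab _ _ (hy _ (Set.mem_image_of_mem _ hx))

theorem TukeyEquiv.dominatingNumber_eq (h : R.TukeyEquiv R') :
    R.dominatingNumber = R'.dominatingNumber :=
  le_antisymm h.1.dominatingNumber_le h.2.dominatingNumber_le

theorem TukeyEquiv.unboundingNumber_eq (h : R.TukeyEquiv R') :
    R.unboundingNumber = R'.unboundingNumber :=
  le_antisymm h.2.unboundingNumber_le h.1.unboundingNumber_le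

end RelSystem

theorem dominatingNumber_inclusionSystem {M : Type u} (I : Set (Set M)) (hI : I.Nonempty) :
    (inclusionSystem I hI).dominatingNumber = cof I := by
  refine le_antisymm (minCard_le_minCard fun E hE => ?_) (minCard_le_minCard fun E hE => ?_)
  · refine ⟨(Subtype.val ⁻¹' E : Set I), fun a => ?_, ?_⟩
    · obtain ⟨b, hb, hab⟩ := hE.2 a.1 a.2
      exact ⟨⟨b, hE.1 hb⟩, hb, hab⟩
    · exact mk_preimage_of_injective _ _ Subtype.val_injective
  · refine ⟨(Subtype.val '' (show Set I from E) : Set (Set M)), ⟨?_, fun a ha => ?_⟩, mk_image_le⟩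
    · rintro _ ⟨a, _, rfl⟩
      exact a.2
    · obtain ⟨b, hb, hab⟩ := hE ⟨a, ha⟩
      exact ⟨_, Set.mem_image_of_mem _ hb, hab⟩

theorem unboundingNumber_inclusionSystem {M : Type u} (I : Set (Set M)) (hI : I.Nonempty)
    (hmono : ∀ a b, a ⊆ b → b ∈ I → a ∈ I) :
    (inclusionSystem I hI).unboundingNumber = add I := by
  refine le_antisymm (minCard_le_minCard fun E hE => ?_) (minCard_le_minCard fun E hE => ?_)
  · refine ⟨(Subtype.val ⁻¹' E : Set I), fun ⟨b, hb⟩ => hE.2 (hmono _ _ ?_ b.2), ?_⟩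
    · exact Set.sUnion_subset fun a ha => hb ⟨a, hE.1 ha⟩ ha
    · exact mk_preimage_of_injective _ _ Subtype.val_injective
  · refine ⟨(Subtype.val '' (show Set I from E) : Set (Set M)), ⟨?_, fun h => hE ?_⟩, mk_image_le⟩
    · rintro _ ⟨a, _, rfl⟩
      exact a.2
    · exact ⟨⟨_, h⟩, fun a ha => Set.subset_sUnion_of_mem (Set.mem_image_of_mem _ ha)⟩

/-! ### Tukey reductions between slalom systems -/

theorem slalomSystem_tukeyLE_of_subset {A B : Set (Set ℕ)} (h : B ⊆ A) (f : ℕ → ℕ) :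
    (slalomSystem A f).TukeyLE (slalomSystem B f) :=
  ⟨id, id, fun _ _ hxs => h hxs⟩

theorem mem_dualFilter_Fin {a : Set ℕ} : a ∈ dualFilter Fin ↔ ∀ᶠ n in atTop, n ∈ a := by
  rw [← Nat.cofinite_eq_atTop]; rfl

theorem mem_positive_Fin {a : Set ℕ} : a ∈ positive Fin ↔ ∃ᶠ n in atTop, n ∈ a := by
  rw [Nat.frequently_atTop_iff_infinite]; rfl

/-- Slaloms of width one are given by partial functions. -/
theorem exists_subset_singleton {f : ℕ → ℕ} {n : ℕ} (hf : f n ≤ 1) (s : Slaloms f) :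
    ∃ k, (s : ℕ → Set ℕ) n ⊆ {k} := by
  have h : ((s : ℕ → Set ℕ) n).encard ≤ 1 := (s.2 n).trans (by exact_mod_cast hf)
  rcases Set.encard_le_one_iff_eq.1 h with h | ⟨k, h⟩
  · exact ⟨0, by simp [h]⟩
  · exact ⟨k, h.le⟩

/-- The slalom of width one given by a function. -/
def singletonSlalom (g : ℕ → ℕ) : Slaloms fun _ => 1 :=
  ⟨fun n => {g n}, fun n => by simp⟩

/-- The `n`-th value to be guessed codes `x` at all pairs `(n, l)` with `l < f n`. The `l`-th
candidate for it is consulted only at the pair `(n, l)`, so the right candidate is right at its own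
pair. -/
theorem pLc_Fin_one_tukeyLE_of_forall (f : ℕ → ℕ) :
    (pLc Fin fun _ => 1).TukeyLE (pLc Fin f) := by
  have hfin : ∀ (s : Slaloms f) n, ∃ w : ℕ → ℕ, ∀ k ∈ (s : ℕ → Set ℕ) n, ∃ l < f n, w l = k := by
    intro s n
    have hs : ((s : ℕ → Set ℕ) n).Finite := Set.finite_of_encard_le_coe (s.2 n)
    refine ⟨fun l => hs.toFinset.toList.getD l 0, fun k hk => ?_⟩
    obtain ⟨l, hl, h⟩ := List.getElem_of_mem (Finset.mem_toList.2 (hs.mem_toFinset.2 hk))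
    refine ⟨l, ?_, (List.getD_eq_getElem _ _ hl).trans h⟩
    have h1 := s.2 n
    rw [hs.encard_eq_coe_toFinset_card] at h1
    rw [Finset.length_toList] at hl
    exact hl.trans_le (by exact_mod_cast h1)
  choose w hw using hfin
  refine ⟨fun x n => initCode (fun l => x (Nat.pair n l)) (f n), fun s => singletonSlalom fun m =>
    evalCode (w s m.unpair.1 m.unpair.2) m.unpair.2, fun x s hxs => ?_⟩
  change _ ∈ positive Fin at hxs
  change _ ∈ positive Fin
  rw [mem_positive_Fin, frequently_atTop] at hxs ⊢
  intro N
  obtain ⟨n, hn, hxn⟩ := hxs N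
  obtain ⟨l, hl, hwl⟩ := hw s n _ hxn
  refine ⟨Nat.pair n l, hn.trans (Nat.left_le_pair n l), ?_⟩
  simp [singletonSlalom, hwl, evalCode_initCode_of_lt _ hl]

theorem slalomSystem_tukeyLE_of_eventually_le {A : Set (Set ℕ)}
    (hA : ∀ a b : Set ℕ, a ∈ A → (∀ᶠ n in atTop, n ∈ a → n ∈ b) → b ∈ A) {f f' : ℕ → ℕ}
    (h : ∀ᶠ n in atTop, f n ≤ f' n) : (slalomSystem A f').TukeyLE (slalomSystem A f) := by
  classical
  refine ⟨id, fun (s : Slaloms f) => ⟨fun n => if f n ≤ f' n then (s : ℕ → Set ℕ) n else ∅, fun n => ?_⟩,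
    fun x s hxs => hA _ _ hxs ?_⟩
  · dsimp only
    split_ifs with hn
    · exact (s.2 n).trans (by exact_mod_cast hn)
    · simp
  · filter_upwards [h] with n hn hx
    simpa [hn] using hx

theorem IsIdealOn.positive_of_eventually {J : Set (Set ℕ)} (hJ : IsIdealOn J) (a b : Set ℕ)
    (ha : a ∈ positive J) (h : ∀ᶠ n in atTop, n ∈ a → n ∈ b) : b ∈ positive J := by
  refine fun hb => ha (hJ.mono _ _ (fun n hn => ?_) (hJ.union _ _ hb (hJ.finite (a \ b) ?_)))
  · by_cases hb : n ∈ b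
    · exact Or.inl hb
    · exact Or.inr ⟨hn, hb⟩
  · rw [← Nat.cofinite_eq_atTop, eventually_cofinite] at h
    exact h.subset fun n hn h' => hn.2 (h' hn.1)

theorem IsIdealOn.Fin_subset {J : Set (Set ℕ)} (hJ : IsIdealOn J) : Fin ⊆ J :=
  fun a ha => hJ.finite a ha

theorem IsIdealOn.pLc_one_tukeyLE {J : Set (Set ℕ)} (hJ : IsIdealOn J)
    (hB : HasBaireProperty J) :
    (pLc J fun _ => 1).TukeyLE (pLc Fin fun _ => 1) := by
  obtain ⟨i, hi, hiJ⟩ := hJ.exists_partition hB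
  obtain ⟨b, hb⟩ := exists_blockIndex hi
  choose g hg using fun (s : Slaloms fun _ => 1) n => exists_subset_singleton (n := n) le_rfl s
  refine ⟨fun x n => initCode x (i (n + 1)), fun s => singletonSlalom fun m =>
    evalCode (g s (b m)) m, fun x s hxs => hiJ _ ?_⟩
  refine (mem_positive_Fin.1 hxs).mono fun n hn m h1 h2 => ?_
  have hgs : initCode x (i (n + 1)) = g s n := hg s n hn
  simp [singletonSlalom, hb n m h1 h2, ← hgs, evalCode_initCode_of_lt x h2]

/-- Pseudo-localization modulo an ideal with the Baire property. -/
theorem IsIdealOn.pLc_tukeyEquiv {J : Set (Set ℕ)} (hJ : IsIdealOn J)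
    (hB : HasBaireProperty J) {h : ℕ → ℕ} (hh : ∀ᶠ n in atTop, 1 ≤ h n) :
    (pLc J h).TukeyEquiv (pLc Fin fun _ => 1) :=
  ⟨(slalomSystem_tukeyLE_of_eventually_le hJ.positive_of_eventually hh).trans
    (hJ.pLc_one_tukeyLE hB),
   (pLc_Fin_one_tukeyLE_of_forall h).trans
    (slalomSystem_tukeyLE_of_subset (A := positive Fin) (B := positive J)
      (fun _ ha h' => ha (hJ.Fin_subset h')) h)⟩

theorem IsIdealOn.Lc_tukeyLE_Fin {J : Set (Set ℕ)} (hJ : IsIdealOn J) (g : ℕ → ℕ) :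
    (Lc J g).TukeyLE (Lc Fin g) :=
  slalomSystem_tukeyLE_of_subset (A := dualFilter J) (B := dualFilter Fin)
    (fun _ ha => hJ.Fin_subset ha) g

theorem IsIdealOn.exists_Lc_Fin_tukeyLE {J : Set (Set ℕ)} (hJ : IsIdealOn J)
    (hB : HasBaireProperty J) (g : ℕ → ℕ) : ∃ g', (Lc Fin g').TukeyLE (Lc J g) := by
  obtain ⟨i, hi, hiJ⟩ := hJ.exists_partition hB
  obtain ⟨b, hb⟩ := exists_blockIndex hi
  refine ⟨fun n => ∑ m ∈ Finset.Ico (i n) (i (n + 1)), g m, fun x m => x (b m),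
    fun (s : Slaloms g) => ⟨fun n => ⋃ m ∈ Finset.Ico (i n) (i (n + 1)), (s : ℕ → Set ℕ) m, fun n => ?_⟩,
    fun x (s : Slaloms g) hxs => ?_⟩
  · refine (Finset.set_encard_biUnion_le _ _).trans ?_
    push_cast
    exact Finset.sum_le_sum fun m _ => s.2 m
  · change _ ∈ dualFilter Fin
    rw [mem_dualFilter_Fin]
    by_contra hcon
    rw [not_eventually] at hcon
    -- If the union over the `n`-th interval misses `x n`, then `s` misses `x ∘ b` throughout that
    -- interval. Infinitely many such `n` would contradict that the set of misses is in `J`.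
    refine hiJ {m | x (b m) ∈ (s : ℕ → Set ℕ) m}ᶜ
      (hcon.mono fun n hn m h1 h2 hm => hn ?_) hxs
    have hm' : x (b m) ∈ (s : ℕ → Set ℕ) m := hm
    rw [hb n m h1 h2] at hm'
    exact Set.mem_biUnion (Finset.mem_coe.2 (Finset.mem_Ico.2 ⟨h1, h2⟩)) hm'

/-- Since `g → ∞`, the `n`-th interval can start so late that `g` is at least `f n` from there on;
the `f n` candidates for the code of `x` then yield few enough values at each point. -/
theorem Lc_Fin_tukeyLE_of_tendsto {g : ℕ → ℕ} (hg : Tendsto g atTop atTop) (f : ℕ → ℕ) :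
    (Lc Fin g).TukeyLE (Lc Fin f) := by
  classical
  obtain ⟨i, hi, hig⟩ : ∃ i : ℕ → ℕ, StrictMono i ∧ ∀ n, ∀ m ≥ i n, f n ≤ g m :=
    extraction_forall_of_eventually' fun n => by
      obtain ⟨N, hN⟩ := eventually_atTop.1 (hg.eventually_ge_atTop (f n))
      exact ⟨N, fun k hk m hm => hN m (hk.trans hm)⟩
  obtain ⟨b, hb⟩ := exists_blockIndex hi
  -- The test can fail only below `i 0`, where `b` is uncontrolled.
  refine ⟨fun x n => initCode x (i (n + 1)), fun (s : Slaloms f) => ⟨fun m => if f (b m) ≤ g m then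
    (fun c => evalCode c m) '' (s : ℕ → Set ℕ) (b m) else ∅, fun m => ?_⟩, fun x s hxs => ?_⟩
  · dsimp only
    split_ifs with h
    · exact (Set.encard_image_le _ _).trans ((s.2 _).trans (by exact_mod_cast h))
    · simp
  · change _ ∈ dualFilter Fin
    rw [mem_dualFilter_Fin]
    obtain ⟨N, hN⟩ := eventually_atTop.1 (mem_dualFilter_Fin.1 hxs)
    filter_upwards [eventually_ge_atTop (i N)] with m hm
    obtain ⟨n, h1, h2⟩ := exists_block hi ((hi.monotone N.zero_le).trans hm)
    have hbm := hb n m h1 h2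
    have hn : N ≤ n := Nat.lt_succ_iff.1 (hi.lt_iff_lt.1 (hm.trans_lt h2))
    change x m ∈ ite _ _ _
    rw [hbm, if_pos (hig n m h1)]
    exact ⟨_, hN n hn, evalCode_initCode_of_lt _ h2⟩

/-! ### Infinitely often equal functions and meager sets -/

/-- A guess `H` that is infinitely often right about codes of finite pieces of `f` restricted to an
infinite set `X` yields a function that agrees with `f` infinitely often on `X`. -/
theorem exists_guess_on_infinite : ∃ G : (ℕ → ℕ) → ℕ → ℕ, ∀ (X : Set ℕ) (f : ℕ → ℕ),
    X.Infinite → ∃ h : ℕ → ℕ, ∀ H : ℕ → ℕ, (∃ᶠ n in atTop, h n = H n) →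
      ∃ᶠ k in atTop, k ∈ X ∧ G H k = f k := by
  classical
  -- The support of the guessed sequence, or a default when it is too small. As `S H n` has more
  -- than `n` elements, Hall's theorem gives distinct representatives `z H n`.
  let S : (ℕ → ℕ) → ℕ → Finset ℕ := fun H n =>
    if n < (finite_support_evalCode (H n)).toFinset.card
      then (finite_support_evalCode (H n)).toFinset else Finset.range (n + 1)
  have hS : ∀ H n, n < (S H n).card := by
    intro H n
    simp only [S]
    split_ifs with h
    · exact h
    · simp
  have hz : ∀ H, ∃ z : ℕ → ℕ, Function.Injective z ∧ ∀ n, z n ∈ S H n := by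
    refine fun H => (Finset.all_card_le_biUnion_card_iff_exists_injective (S H)).1 fun s => ?_
    rcases s.eq_empty_or_nonempty with rfl | hs
    · simp
    · have h1 : s.card ≤ s.max' hs + 1 := by
        simpa using Finset.card_le_card fun n hn =>
          Finset.mem_range.2 (Nat.lt_succ_of_le (s.le_max' n hn))
      exact (h1.trans (hS H _)).trans
        (Finset.card_le_card (Finset.subset_biUnion_of_mem (S H) (s.max'_mem hs)))
  choose z hzi hzS using hz
  refine ⟨fun H k => evalCode (H (Function.invFun (z H) k)) k - 1, fun X f hX => ?_⟩
  -- The shift makes the support exactly `X`, so for a correct guess the representative lies in `X`.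
  -- The final `- 1` above undoes it.
  let f' : ℕ → ℕ := fun k => if k ∈ X then f k + 1 else 0
  refine ⟨fun n => initCode f' (Nat.nth (· ∈ X) n + 1), fun H hH => ?_⟩
  rw [Nat.frequently_atTop_iff_infinite] at hH ⊢
  refine (hH.image (hzi H).injOn).mono ?_
  rintro _ ⟨n, hn, rfl⟩
  change initCode f' _ = H n at hn
  have hmono : StrictMono (Nat.nth (· ∈ X)) := Nat.nth_strictMono hX
  have hcard : n < (finite_support_evalCode (H n)).toFinset.card := by
    have : (Finset.range (n + 1)).image (Nat.nth (· ∈ X)) ⊆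
        (finite_support_evalCode (H n)).toFinset := by
      intro k hk
      obtain ⟨l, hl, rfl⟩ := Finset.mem_image.1 hk
      have hmem : Nat.nth (· ∈ X) l ∈ X := Nat.nth_mem_of_infinite hX l
      have hle : Nat.nth (· ∈ X) l ≤ Nat.nth (· ∈ X) n :=
        hmono.monotone (Nat.lt_succ_iff.1 (Finset.mem_range.1 hl))
      simp only [Set.Finite.mem_toFinset, Set.mem_ofPred_eq, ← hn]
      rw [evalCode_initCode_of_lt _ (Nat.lt_succ_of_le hle)]
      simp [f', hmem]
    have := Finset.card_le_card this
    rwa [Finset.card_image_of_injective _ hmono.injective, Finset.card_range] at this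
  have hzn := hzS H n
  simp only [S, if_pos hcard, Set.Finite.mem_toFinset, Set.mem_ofPred_eq, ← hn,
    evalCode_initCode] at hzn
  have hlt : z H n < Nat.nth (· ∈ X) n + 1 := by
    by_contra h
    simp [h] at hzn
  have hX' : z H n ∈ X := by
    by_contra h
    simp [f', h] at hzn
  refine ⟨hX', ?_⟩
  dsimp only
  rw [Function.leftInverse_invFun (hzi H) n, ← hn, evalCode_initCode_of_lt _ hlt]
  simp [f', hX']

/-- For every `g` there is an interval partition whose `(k+2)`-nd point bounds the values of `g`
below the `(k+1)`-st point. -/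
theorem exists_partition_bounding (g : ℕ → ℕ) :
    ∃ j : ℕ → ℕ, StrictMono j ∧ ∀ k, ∀ n < j (k + 1), g n ≤ j (k + 2) := by
  let nx : ℕ → ℕ := fun a => a + 1 + ∑ n ∈ Finset.range a, g n
  let j : ℕ → ℕ := fun k => Nat.rec 0 (fun _ a => nx a) k
  refine ⟨j, strictMono_nat_of_lt_succ fun k => ?_, fun k n hn => ?_⟩
  · change j k < j k + 1 + _
    omega
  · change g n ≤ j (k + 1) + 1 + _
    exact (Finset.single_le_sum (f := g) (fun _ _ => Nat.zero_le _)
      (Finset.mem_range.2 hn)).trans (Nat.le_add_left _ _)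

/-- If `i n₊₂ = g n` infinitely often, then infinitely many intervals of the partition `j` bounding
`g` contain an interval of `i`. -/
theorem infinite_setOf_block_subset {i j g : ℕ → ℕ} (hi : StrictMono i) (hj : StrictMono j)
    (hjg : ∀ k, ∀ n < j (k + 1), g n ≤ j (k + 2)) (h : ∃ᶠ n in atTop, i (n + 2) = g n) :
    {k | ∃ m, j k ≤ i m ∧ i (m + 1) ≤ j (k + 1)}.Infinite := by
  rw [← Nat.frequently_atTop_iff_infinite, frequently_atTop]
  intro N
  obtain ⟨n, hn, hin⟩ := (frequently_atTop.1 h) (j N)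
  obtain ⟨k, hk1, hk2⟩ := exists_block hj ((hj.monotone N.zero_le).trans hn)
  have hNk : N ≤ k := Nat.lt_succ_iff.1 (hj.lt_iff_lt.1 (hn.trans_lt hk2))
  have hend : i (n + 2) ≤ j (k + 2) := hin.trans_le (hjg k n hk2)
  -- The point `i (n + 1)` lies either before or after `j (k + 1)`: the interval of `i` to its left,
  -- or the one to its right, fits.
  rcases le_or_gt (i (n + 1)) (j (k + 1)) with hle | hlt
  · exact ⟨k, hNk, n, hk1.trans (hi.id_le n), hle⟩
  · exact ⟨k + 1, hNk.trans k.le_succ, n + 1, hlt.le, hend⟩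

/-- Two successive infinitely-often-equal guesses suffice to leave a meager set. -/
theorem exists_evading_meagre : ∃ Ψ : (ℕ → ℕ) → (ℕ → ℕ) → ℕ → _root_.Fin 2,
    ∀ A : Set (ℕ → _root_.Fin 2), IsMeagre A → ∃ f : ℕ → ℕ, ∀ g : ℕ → ℕ,
      (∃ᶠ n in atTop, f n = g n) → ∃ f' : ℕ → ℕ, ∀ g' : ℕ → ℕ,
        (∃ᶠ n in atTop, f' n = g' n) → Ψ g g' ∉ A := by
  obtain ⟨G, hG⟩ := exists_guess_on_infinite
  choose j hj hjg using exists_partition_bounding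
  choose b hb using fun g => exists_blockIndex (hj g)
  refine ⟨fun g g' m => Fin.ofNat 2 (evalCode (G g' (b g m)) m), fun A hA => ?_⟩
  obtain ⟨i, x, hi, hx⟩ := exists_chopped_of_isMeagre hA
  -- The first guess concerns the partition. Once `g` is known, the second concerns codes of `x` on
  -- those intervals of `j g` that contain one of `i`.
  refine ⟨fun n => i (n + 2), fun g hg => ?_⟩
  have hX := infinite_setOf_block_subset hi (hj g) (hjg g) hg
  obtain ⟨f', hf'⟩ := hG _ (fun k => initCode (fun m => (x m : ℕ)) (j g (k + 1))) hX
  refine ⟨f', fun g' hg' => hx _ (frequently_atTop.2 fun N => ?_)⟩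
  obtain ⟨k, hk, ⟨n, hn1, hn2⟩, hGk⟩ := (frequently_atTop.1 (hf' g' hg')) (i N)
  refine ⟨n, hi.le_iff_le.1 (hk.trans (((hj g).id_le k).trans hn1)), fun m h1 h2 => ?_⟩
  dsimp only
  rw [hb g k m (hn1.trans h1) (h2.trans_le hn2), hGk,
    evalCode_initCode_of_lt _ (h2.trans_le hn2)]
  simp

/-! ### Transfer between the reals and spaces of sequences -/

theorem isMeagre_preimage_of_interior_image {X Y : Type*} [TopologicalSpace X]
    [TopologicalSpace Y] {f : X → Y} (hf : Continuous f)
    (hi : ∀ U : Set X, IsOpen U → U.Nonempty → (interior (f '' U)).Nonempty) {A : Set Y}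
    (hA : IsMeagre A) : IsMeagre (f ⁻¹' A) := by
  obtain ⟨S, hS1, hS2, hS3⟩ := isMeagre_iff_countable_union_isNowhereDense.1 hA
  refine IsMeagre.mono (s := ⋃ s ∈ S, f ⁻¹' s) ?_ (isMeagre_biUnion hS2 fun s hs =>
    IsNowhereDense.isMeagre ?_)
  · intro x hx
    obtain ⟨s, hs, hxs⟩ := hS3 hx
    exact Set.mem_biUnion hs hxs
  · by_contra h
    obtain ⟨y, hy⟩ := hi _ isOpen_interior (Set.nonempty_iff_ne_empty.2 h)
    have hsub : f '' interior (closure (f ⁻¹' s)) ⊆ closure s := by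
      rintro _ ⟨x, hx, rfl⟩
      exact hf.closure_preimage_subset s (interior_subset hx)
    have := interior_mono hsub hy
    rw [hS1 s hs] at this
    exact this

/-- Fixing `N` binary digits and letting the rest vary gives a dyadic interval of length `2⁻ᴺ`. -/
theorem interior_image_ofDigits_nonempty {U : Set (ℕ → _root_.Fin 2)} (hU : IsOpen U)
    (hne : U.Nonempty) : (interior (Real.ofDigits '' U)).Nonempty := by
  obtain ⟨z, hz⟩ := hne
  obtain ⟨N, hN⟩ := exists_cylinder_subset hU hz
  set c : ℝ := ∑ i ∈ Finset.range N, Real.ofDigitsTerm z i with hc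
  have hp : (0 : ℝ) < (2 : ℝ) ^ N := by positivity
  have hsub : Set.Ioo c (c + ((2 : ℝ) ^ N)⁻¹) ⊆ Real.ofDigits '' U := by
    intro r hr
    obtain ⟨t, -, ht⟩ := Real.ofDigits_SurjOn (b := 2) one_lt_two
      (show (2 : ℝ) ^ N * (r - c) ∈ Set.Icc (0 : ℝ) 1 from
        ⟨mul_nonneg hp.le (sub_nonneg.2 hr.1.le), by
          have := hr.2.le
          rw [mul_comm, ← le_div_iff₀ hp, one_div]
          linarith⟩)
    refine ⟨fun n => if n < N then z n else t (n - N), hN _ fun m hm => by simp [hm], ?_⟩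
    rw [Real.ofDigits_eq_sum_add_ofDigits _ N]
    have h1 : (fun i => (fun n => if n < N then z n else t (n - N)) (i + N)) = t := by
      ext i; simp
    have h2 : ∑ i ∈ Finset.range N,
        Real.ofDigitsTerm (fun n => if n < N then z n else t (n - N)) i = c :=
      Finset.sum_congr rfl fun i hi => by
        simp [Real.ofDigitsTerm, Finset.mem_range.1 hi]
    rw [h1, h2, ht]
    push_cast
    field_simp
    ring
  have hlt : c < c + ((2 : ℝ) ^ N)⁻¹ := by linarith [inv_pos.2 hp]
  exact (Set.nonempty_Ioo.2 hlt).mono (interior_maximal hsub isOpen_Ioo)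

theorem isMeagre_preimage_ofDigits {A : Set ℝ} (hA : IsMeagre A) :
    IsMeagre (Real.ofDigits (b := 2) ⁻¹' A) :=
  isMeagre_preimage_of_interior_image Real.continuous_ofDigits
    (fun _ hU hne => interior_image_ofDigits_nonempty hU hne) hA

/-- A sequence of functions on the reals each taking all values on an open set inside every
interval that is not too short. -/
noncomputable def realToSeq (r : ℝ) (n : ℕ) : ℕ := ⌊(Int.fract (2 ^ n * r))⁻¹⌋₊ - 1

theorem isMeagre_setOf_not_frequently_eq (x : ℕ → ℕ) :
    IsMeagre {r : ℝ | ¬ ∃ᶠ n in atTop, x n = realToSeq r n} := by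
  have hsub : {r : ℝ | ¬ ∃ᶠ n in atTop, x n = realToSeq r n} ⊆
      ⋃ N : ℕ, {r : ℝ | ∀ n ≥ N, x n ≠ realToSeq r n} := by
    intro r hr
    obtain ⟨N, hN⟩ := eventually_atTop.1 (not_frequently.1 hr)
    exact Set.mem_iUnion.2 ⟨N, hN⟩
  refine IsMeagre.mono hsub (isMeagre_iUnion fun N => IsNowhereDense.isMeagre ?_)
  rw [IsNowhereDense, interior_eq_empty_iff_dense_compl, dense_iff_inter_open]
  rintro U hU ⟨r, hr⟩
  obtain ⟨ε, hε, hball⟩ := Metric.isOpen_iff.1 hU r hr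
  obtain ⟨n, hn, hnN⟩ : ∃ n : ℕ, ((1 : ℝ) / 2) ^ n < ε ∧ N ≤ n :=
    (((tendsto_pow_atTop_nhds_zero_of_lt_one (by norm_num) (by norm_num :
      (1 : ℝ) / 2 < 1)).eventually (gt_mem_nhds hε)).and (eventually_ge_atTop N)).exists
  have hp : (0 : ℝ) < 2 ^ n := by positivity
  set k : ℝ := (x n : ℝ) with hk
  have hk0 : 0 ≤ k := Nat.cast_nonneg _
  set c : ℝ := (⌊2 ^ n * r⌋ : ℝ) with hc
  -- Here the fractional part of `2 ^ n * s` lies between `1 / (k + 2)` and `1 / (k + 1)`, so the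
  -- floor of its inverse is `k + 1`.
  set V : Set ℝ := Set.Ioo ((c + (k + 2)⁻¹) / 2 ^ n) ((c + (k + 1)⁻¹) / 2 ^ n) with hV
  have hk1 : (k + 1)⁻¹ ≤ 1 := inv_le_one_of_one_le₀ (by linarith)
  have hk2 : 0 < (k + 2)⁻¹ := by positivity
  have hVeq : ∀ s ∈ V, x n = realToSeq s n := by
    rintro s ⟨h1, h2⟩
    rw [div_lt_iff₀ hp] at h1
    rw [lt_div_iff₀ hp] at h2
    have hfl : ⌊2 ^ n * s⌋ = ⌊2 ^ n * r⌋ := by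
      rw [Int.floor_eq_iff]
      constructor <;> linarith
    have hfr : Int.fract (2 ^ n * s) = 2 ^ n * s - c := by rw [Int.fract, hfl]
    have e1 : (k + 2)⁻¹ < 2 ^ n * s - c := by linarith
    have e2 : 2 ^ n * s - c < (k + 1)⁻¹ := by linarith
    have hpos : 0 < 2 ^ n * s - c := hk2.trans e1
    have : ⌊(2 ^ n * s - c)⁻¹⌋₊ = x n + 1 := by
      rw [Nat.floor_eq_iff (by positivity)]
      push_cast
      constructor
      · rw [← hk]
        exact ((lt_inv_comm₀ hpos (by positivity)).1 e2).le
      · rw [← hk]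
        have := (inv_lt_comm₀ (by positivity) hpos).1 e1
        linarith
    rw [realToSeq, hfr, this]
    rfl
  obtain ⟨s, hs⟩ : V.Nonempty := by
    rw [hV, Set.nonempty_Ioo]
    gcongr
    norm_num
  refine ⟨s, hball ?_, ?_⟩
  · rw [Metric.mem_ball, Real.dist_eq]
    refine lt_of_lt_of_le ?_ hn.le
    have hfr := Int.floor_le (2 ^ n * r)
    have hfr' := Int.lt_floor_add_one (2 ^ n * r)
    have h1 := hs.1
    have h2 := hs.2
    rw [div_lt_iff₀ hp] at h1
    rw [lt_div_iff₀ hp] at h2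
    have : |2 ^ n * (s - r)| < 1 := by
      rw [abs_lt]
      constructor <;> linarith
    rw [abs_mul, abs_of_pos hp] at this
    rw [one_div, inv_pow, ← one_div, lt_div_iff₀ hp]
    linarith
  · intro hcl
    obtain ⟨t, htV, ht⟩ := mem_closure_iff.1 hcl V isOpen_Ioo hs
    exact ht n hnN (hVeq t htV)

/-! ### Pseudo-localization and the meager ideal -/

theorem pLc_Fin_rel_singletonSlalom {x g : ℕ → ℕ} :
    (pLc Fin fun _ => 1).rel x (singletonSlalom g) ↔ ∃ᶠ n in atTop, x n = g n :=
  mem_positive_Fin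

theorem exists_frequently_eq_of_rel (s : Slaloms fun _ => 1) :
    ∃ g : ℕ → ℕ, ∀ x : ℕ → ℕ, (pLc Fin fun _ => 1).rel x s → ∃ᶠ n in atTop, x n = g n := by
  choose g hg using fun n => exists_subset_singleton (n := n) le_rfl s
  exact ⟨g, fun x hx => (mem_positive_Fin.1 hx).mono fun n hn => hg n hn⟩

theorem isMeagre_of_countable {A : Set ℝ} (hA : A.Countable) : IsMeagre A := by
  rw [← Set.biUnion_of_singleton A]
  refine isMeagre_biUnion hA fun r _ => IsNowhereDense.isMeagre ?_
  rw [IsNowhereDense, closure_singleton, interior_singleton]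

theorem dominatingNumber_pLc_Fin_one : (pLc Fin fun _ => 1).dominatingNumber = non meager := by
  refine le_antisymm (minCard_le_minCard fun A hA => ?_) (minCard_le_minCard fun D hD => ?_)
  · refine ⟨(fun r => singletonSlalom (realToSeq r)) '' A, fun x => ?_, mk_image_le⟩
    by_contra! hcon
    refine hA (IsMeagre.mono (fun r hr => ?_) (isMeagre_setOf_not_frequently_eq x))
    exact fun h => hcon _ (Set.mem_image_of_mem _ hr) (pLc_Fin_rel_singletonSlalom.2 h)
  · obtain ⟨Ψ, hΨ⟩ := exists_evading_meagre
    choose γ hγ using exists_frequently_eq_of_rel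
    let E : Set ℝ := Set.range fun p : ↥D × ↥D => Real.ofDigits (Ψ (γ p.1.1) (γ p.2.1))
    have hE : ¬ IsMeagre E := by
      intro h
      obtain ⟨f, hf⟩ := hΨ _ (isMeagre_preimage_ofDigits h)
      obtain ⟨s, hs, hfs⟩ := hD f
      obtain ⟨f', hf'⟩ := hf _ (hγ s f hfs)
      obtain ⟨t, ht, hft⟩ := hD f'
      exact hf' _ (hγ t f' hft) ⟨(⟨s, hs⟩, ⟨t, ht⟩), rfl⟩
    -- Needed so that pairs from `D` are no more numerous than `D`.
    have hinf : ℵ₀ ≤ #D := by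
      by_contra h
      have : Finite D := lt_aleph0_iff_finite.1 (not_le.1 h)
      exact hE (isMeagre_of_countable (Set.countable_range _))
    refine ⟨E, hE, mk_range_le.trans ?_⟩
    rw [mk_prod, lift_id]
    exact (mul_eq_self hinf).le

theorem unboundingNumber_pLc_Fin_one : (pLc Fin fun _ => 1).unboundingNumber = cov meager := by
  refine le_antisymm ?_ (minCard_le_minCard fun F hF => ?_)
  · obtain ⟨Ψ, hΨ⟩ := exists_evading_meagre
    choose γ hγ using exists_frequently_eq_of_rel
    refine le_iInf fun ⟨C, hC, hcov⟩ => ?_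
    by_contra hlt
    -- A family indexed by `C` is too small to be unbounded. This is applied twice, once for each
    -- guess.
    have hb : ∀ φ : C → ℕ → ℕ, ∃ g : ℕ → ℕ, ∀ A, ∃ᶠ n in atTop, φ A n = g n := by
      intro φ
      by_contra hcon
      refine hlt ((minCard_le (D := Set.range φ) ?_).trans (WithTop.coe_le_coe.2 mk_range_le))
      rintro ⟨s, hs⟩
      exact hcon ⟨γ s, fun A => hγ s _ (hs _ (Set.mem_range_self A))⟩
    choose f hf using fun A : C => hΨ _ (isMeagre_preimage_ofDigits (hC A.2))
    obtain ⟨g, hg⟩ := hb f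
    choose f' hf' using fun A => hf A g (hg A)
    obtain ⟨g', hg'⟩ := hb f'
    obtain ⟨A, hA, hmem⟩ := Set.mem_sUnion.1
      (hcov ▸ Set.mem_univ (Real.ofDigits (Ψ g g')) : Real.ofDigits (Ψ g g') ∈ ⋃₀ C)
    exact hf' ⟨A, hA⟩ g' (hg' _) hmem
  · refine ⟨(fun x : ℕ → ℕ => {r : ℝ | ¬ ∃ᶠ n in atTop, x n = realToSeq r n}) '' F,
      ⟨?_, ?_⟩, mk_image_le⟩
    · rintro _ ⟨x, _, rfl⟩
      exact isMeagre_setOf_not_frequently_eq x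
    · refine Set.eq_univ_of_forall fun r => ?_
      by_contra hcon
      refine hF ⟨singletonSlalom (realToSeq r), fun x hx => pLc_Fin_rel_singletonSlalom.2 ?_⟩
      by_contra h
      exact hcon ⟨_, Set.mem_image_of_mem _ hx, h⟩

/-! ### Null sets and localization -/

open scoped unitInterval ENNReal

theorem exists_nat_basis (X : Type*) [TopologicalSpace X] [SecondCountableTopology X] :
    ∃ b : ℕ → Set X, (∀ j, IsOpen (b j)) ∧
      ∀ V : Set X, IsOpen V → ∀ x ∈ V, ∃ j, x ∈ b j ∧ b j ⊆ V := by
  obtain ⟨B, hBc, -, hB⟩ := TopologicalSpace.exists_countable_basis X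
  obtain ⟨b, hb⟩ := (hBc.insert ∅).exists_eq_range (Set.insert_nonempty _ _)
  refine ⟨b, fun j => ?_, fun V hV x hx => ?_⟩
  · have : b j ∈ insert ∅ B := hb ▸ Set.mem_range_self j
    rcases this with h | h
    · rw [h]; exact isOpen_empty
    · exact hB.isOpen h
  · obtain ⟨U, hU, hxU, hUV⟩ := hB.exists_subset_of_mem_open hx hV
    obtain ⟨j, rfl⟩ : U ∈ Set.range b := hb ▸ Set.mem_insert_of_mem _ hU
    exact ⟨j, hxU, hUV⟩

/-- There is a countable algebra of sets of reals such that every open set is a disjoint union of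
countably many of its members. -/
theorem exists_countable_setAlgebra : ∃ 𝒜 : Set (Set ℝ), IsSetAlgebra 𝒜 ∧ 𝒜.Countable ∧
    (∀ s ∈ 𝒜, MeasurableSet s) ∧ ∀ O : Set ℝ, IsOpen O →
      ∃ D : ℕ → Set ℝ, (∀ i, D i ∈ 𝒜) ∧ Pairwise (Function.onFun Disjoint D) ∧ ⋃ i, D i = O := by
  classical
  obtain ⟨b, hbo, hb⟩ := exists_nat_basis ℝ
  have halg := isSetAlgebra_generateSetAlgebra (𝒜 := Set.range b)
  refine ⟨generateSetAlgebra (Set.range b), halg,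
    countable_generateSetAlgebra (Set.countable_range b), fun s hs => ?_, fun O hO => ?_⟩
  · have h := MeasurableSpace.measurableSet_generateFrom hs
    rw [generateFrom_generateSetAlgebra_eq] at h
    refine MeasurableSpace.generateFrom_le ?_ s h
    rintro _ ⟨j, rfl⟩
    exact (hbo j).measurableSet
  · let f : ℕ → Set ℝ := fun j => if b j ⊆ O then b j else ∅
    refine ⟨disjointed f, fun i => halg.isSetRing.disjointed_mem (fun j => ?_) i,
      disjoint_disjointed f, ?_⟩
    · simp only [f]
      split_ifs
      · exact self_subset_generateSetAlgebra (Set.mem_range_self j)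
      · exact halg.empty_mem
    · rw [iUnion_disjointed]
      refine Set.Subset.antisymm (Set.iUnion_subset fun j => ?_) fun r hr => ?_
      · simp only [f]
        split_ifs with h
        · exact h
        · exact Set.empty_subset _
      · obtain ⟨j, hj, hjO⟩ := hb O hO r hr
        exact Set.mem_iUnion.2 ⟨j, by simpa [f, hjO] using hj⟩

/-- A null set is covered infinitely often by a sequence of members of a suitable countable algebra
whose measures are as small as prescribed. -/
theorem exists_cover_of_null {𝒜 : Set (Set ℝ)} (halg : IsSetAlgebra 𝒜)
    (hmeas : ∀ s ∈ 𝒜, MeasurableSet s)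
    (hopen : ∀ O : Set ℝ, IsOpen O →
      ∃ D : ℕ → Set ℝ, (∀ i, D i ∈ 𝒜) ∧ Pairwise (Function.onFun Disjoint D) ∧ ⋃ i, D i = O)
    {A : Set ℝ} (hA : volume A = 0) {ε : ℕ → ℝ≥0∞} (hε : ∀ n, 0 < ε n) :
    ∃ C : ℕ → Set ℝ, (∀ n, C n ∈ 𝒜) ∧ (∀ n, volume (C n) ≤ ε n) ∧
      ∀ r ∈ A, ∃ᶠ n in atTop, r ∈ C n := by
  obtain ⟨δ, hδ, hδsum⟩ := ENNReal.exists_pos_sum_of_countable' one_ne_zero ℕ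
  choose O hAO hO hOδ using fun j => A.exists_isOpen_lt_of_lt (δ j) (hA ▸ hδ j)
  choose D hD𝒜 hDd hDO using fun j => hopen (O j) (hO j)
  let D' : ℕ → Set ℝ := fun m => D m.unpair.1 m.unpair.2
  have hsum : ∑' m, volume (D' m) ≠ ∞ := by
    have h1 : ∑' m, volume (D' m) = ∑' p : ℕ × ℕ, volume (D p.1 p.2) :=
      Nat.pairEquiv.symm.tsum_eq fun p : ℕ × ℕ => volume (D p.1 p.2)
    have h2 : ∀ j, ∑' i, volume (D j i) ≤ δ j := fun j => by
      rw [← measure_iUnion (hDd j) fun i => hmeas _ (hD𝒜 j i), hDO j]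
      exact (hOδ j).le
    rw [h1, ENNReal.tsum_prod (f := fun j i => volume (D j i))]
    exact ((ENNReal.tsum_le_tsum h2).trans_lt (hδsum.trans ENNReal.one_lt_top)).ne
  -- Cutting the summable sequence `D'` at these points makes the `n`-th block small. A point of the
  -- null set lies in some piece of every `O j`, hence in infinitely many blocks.
  obtain ⟨i, hi, hiε⟩ : ∃ i : ℕ → ℕ, StrictMono i ∧ ∀ n, ∑' k, volume (D' (k + i n)) < ε n :=
    extraction_forall_of_eventually fun n =>
      (ENNReal.tendsto_sum_nat_add _ hsum).eventually (gt_mem_nhds (hε n))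
  refine ⟨fun n => ⋃ m ∈ Finset.Ico (i n) (i (n + 1)), D' m,
    fun n => halg.biUnion_mem _ fun m _ => hD𝒜 _ _, fun n => ?_, fun r hr => ?_⟩
  · refine (measure_biUnion_finset_le _ _).trans (le_trans ?_ (hiε n).le)
    rw [Finset.sum_Ico_eq_sum_range]
    simp_rw [add_comm (i n)]
    exact ENNReal.sum_le_tsum _
  · rw [frequently_atTop]
    intro N
    obtain ⟨l, hl⟩ := Set.mem_iUnion.1 ((hDO (i N)).symm ▸ hAO _ hr : r ∈ ⋃ l, D (i N) l)
    have hm : i N ≤ Nat.pair (i N) l := Nat.left_le_pair _ _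
    obtain ⟨n, h1, h2⟩ := exists_block hi ((hi.monotone N.zero_le).trans hm)
    refine ⟨n, Nat.lt_succ_iff.1 (hi.lt_iff_lt.1 (hm.trans_lt h2)),
      Set.mem_biUnion (Finset.mem_coe.2 (Finset.mem_Ico.2 ⟨h1, h2⟩)) ?_⟩
    simpa [D'] using hl

/-- A null set is covered infinitely often by tiny coded sets. A slalom catching almost all codes
yields a limsup set that contains it and is null by Borel–Cantelli. -/
theorem null_tukeyLE_Lc_Fin (g : ℕ → ℕ) :
    (inclusionSystem null null_nonempty).TukeyLE (Lc Fin g) := by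
  classical
  obtain ⟨𝒜, halg, hcount, hmeas, hopen⟩ := exists_countable_setAlgebra
  obtain ⟨e, he⟩ := hcount.exists_eq_range ⟨∅, halg.empty_mem⟩
  obtain ⟨δ, hδ, hδsum⟩ := ENNReal.exists_pos_sum_of_countable' one_ne_zero ℕ
  -- At most `g n` sets of this measure have union of measure at most `δ n`; the `+ 1` covers `g n =
  -- 0`.
  let ε : ℕ → ℝ≥0∞ := fun n => δ n / (g n + 1 : ℕ)
  have hε : ∀ n, 0 < ε n := fun n => ENNReal.div_pos (hδ n).ne' (ENNReal.natCast_ne_top _)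
  have hcode : ∀ A : null, ∃ c : ℕ → ℕ, (∀ n, volume (e (c n)) ≤ ε n) ∧
      ∀ r ∈ (A : Set ℝ), ∃ᶠ n in atTop, r ∈ e (c n) := by
    intro A
    obtain ⟨C, hC, hCε, hAC⟩ := exists_cover_of_null halg hmeas hopen A.2 hε
    choose c hc using fun n => (he ▸ hC n : C n ∈ Set.range e)
    exact ⟨c, fun n => by rw [hc]; exact hCε n, fun r hr => by simpa only [hc] using hAC r hr⟩
  choose c hcε hc using hcode
  let T : Slaloms g → ℕ → Set ℝ := fun s n =>
    ⋃ k ∈ {k ∈ (s : ℕ → Set ℕ) n | volume (e k) ≤ ε n}, e k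
  have hT : ∀ s n, volume (T s n) ≤ δ n := by
    intro s n
    have hs : ((s : ℕ → Set ℕ) n).Finite := Set.finite_of_encard_le_coe (s.2 n)
    have hs' : {k ∈ (s : ℕ → Set ℕ) n | volume (e k) ≤ ε n}.Finite := hs.subset fun k hk => hk.1
    have hcard : hs'.toFinset.card ≤ g n + 1 := by
      have h1 := (Set.encard_le_encard (fun k hk => hk.1 :
        {k ∈ (s : ℕ → Set ℕ) n | volume (e k) ≤ ε n} ⊆ _)).trans (s.2 n)
      rw [hs'.encard_eq_coe_toFinset_card] at h1
      exact (Nat.cast_le.1 h1).trans (Nat.le_succ _)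
    have h2 : T s n = ⋃ k ∈ hs'.toFinset, e k := by simp only [T, Set.Finite.mem_toFinset]
    rw [h2]
    calc volume (⋃ k ∈ hs'.toFinset, e k) ≤ ∑ k ∈ hs'.toFinset, volume (e k) :=
          measure_biUnion_finset_le _ _
      _ ≤ ∑ _k ∈ hs'.toFinset, ε n :=
          Finset.sum_le_sum fun k hk => ((hs'.mem_toFinset).1 hk).2
      _ = hs'.toFinset.card * ε n := by rw [Finset.sum_const, nsmul_eq_mul]
      _ ≤ (g n + 1 : ℕ) * ε n := by gcongr
      _ ≤ δ n := ENNReal.mul_div_le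
  refine ⟨c, fun (s : Slaloms g) => ⟨{r | ∃ᶠ n in atTop, r ∈ T s n}, ?_⟩, fun A (s : Slaloms g) hAs r hr => ?_⟩
  · exact measure_setOfPred_frequently_eq_zero
      ((ENNReal.tsum_le_tsum (hT s)).trans_lt (hδsum.trans ENNReal.one_lt_top)).ne
  · refine ((hc A r hr).and_eventually (mem_dualFilter_Fin.1 hAs)).mono fun n hn => ?_
    exact Set.mem_biUnion (show c A n ∈ {k ∈ (s : ℕ → Set ℕ) n | volume (e k) ≤ ε n} from
      ⟨hn.2, hcε A n⟩) hn.1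

/-- In the unit interval there are, for each `n`, infinitely many independent sets of measure
`2⁻ⁿ`. -/
theorem exists_independent_sets : ∃ W : ℕ → ℕ → Set I, (∀ n k, MeasurableSet (W n k)) ∧
    (∀ n k, volume (W n k) = ENNReal.ofReal ((1 / 2) ^ n)) ∧
    ∀ n (S : Finset ℕ), volume (⋂ k ∈ S, (W n k)ᶜ) = ENNReal.ofReal (1 - (1 / 2) ^ n) ^ S.card := by
  obtain ⟨f, hf, hmap⟩ := Measure.exists_measurable_map_eq
    (Measure.infinitePi fun _ : ℕ => (volume : Measure I))
  let t : ℕ → I := fun n => ⟨(1 / 2) ^ n, by positivity, pow_le_one₀ (by norm_num) (by norm_num)⟩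
  have hmp : MeasurePreserving f volume (Measure.infinitePi fun _ : ℕ => (volume : Measure I)) :=
    ⟨hf, hmap⟩
  -- The same coordinates serve every `n`: independence is claimed only in `k` for fixed `n`.
  refine ⟨fun n k => f ⁻¹' (Function.eval k ⁻¹' Set.Iio (t n)), fun n k => ?_, fun n k => ?_,
    fun n S => ?_⟩
  · exact hf (measurable_pi_apply k measurableSet_Iio)
  · rw [hmp.measure_preimage (measurable_pi_apply k measurableSet_Iio).nullMeasurableSet,
      (measurePreserving_eval_infinitePi _ k).measure_preimage
        measurableSet_Iio.nullMeasurableSet, unitInterval.volume_Iio]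
  · have : ⋂ k ∈ S, (f ⁻¹' (Function.eval k ⁻¹' Set.Iio (t n)))ᶜ =
        f ⁻¹' ((S : Set ℕ).pi fun _ => Set.Ici (t n)) := by
      ext r
      simp [Set.mem_pi]
    rw [this, hmp.measure_preimage (MeasurableSet.pi S.countable_toSet
      fun _ _ => measurableSet_Ici).nullMeasurableSet,
      Measure.infinitePi_pi _ fun _ _ => measurableSet_Ici]
    simp [unitInterval.volume_Ici, t]

/-- A null set can be avoided by a closed set that meets no open set in a non-empty null set and on
which countably many given measurable sets are relatively open. -/
theorem exists_isClosed_avoiding_null {W : ℕ → ℕ → Set I} (hW : ∀ n k, MeasurableSet (W n k))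
    {Z : Set I} (hZ : volume Z = 0) :
    ∃ K : Set I, IsClosed K ∧ K.Nonempty ∧ Disjoint K Z ∧
      (∀ n k, ∃ O, IsOpen O ∧ ∀ r ∈ K, r ∈ O ↔ r ∈ W n k) ∧
      ∀ V, IsOpen V → (K ∩ V).Nonempty → 0 < volume (K ∩ V) := by
  have half : (0 : ℝ≥0∞) < 1 / 2 := by simp
  obtain ⟨U₀, hZU, hU₀, hU₀m⟩ := Z.exists_isOpen_lt_of_lt (1 / 2) (hZ ▸ half)
  obtain ⟨δ, hδ, hδsum⟩ := ENNReal.exists_pos_sum_of_countable' half.ne' (ℕ × ℕ)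
  choose O hWO hO _ hOm using fun p : ℕ × ℕ =>
    (hW p.1 p.2).exists_isOpen_sdiff_lt (measure_ne_top volume _) (hδ p).ne'
  -- Off `U p` the measurable set `W p.1 p.2` coincides with the open set `O p`; this is the
  -- relative openness on `K`.
  choose U hOU hU hUm using fun p : ℕ × ℕ => (O p \ W p.1 p.2).exists_isOpen_lt_of_lt _ (hOm p)
  set K : Set I := (U₀ ∪ ⋃ p, U p)ᶜ with hK
  have hKc : IsClosed K := (hU₀.union (isOpen_iUnion hU)).isClosed_compl
  have hKm : volume K ≠ 0 := by
    intro h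
    have h1 : volume (U₀ ∪ ⋃ p, U p) = 1 :=
      (prob_compl_eq_zero_iff (hU₀.union (isOpen_iUnion hU)).measurableSet).1 h
    have h2 : volume (U₀ ∪ ⋃ p, U p) < 1 / 2 + 1 / 2 :=
      (measure_union_le _ _).trans_lt (ENNReal.add_lt_add hU₀m
        ((measure_iUnion_le _).trans_lt
          ((ENNReal.tsum_le_tsum fun p => (hUm p).le).trans_lt hδsum)))
    rw [h1, ENNReal.add_halves] at h2
    exact lt_irrefl _ h2
  obtain ⟨b, hbo, hb⟩ := exists_nat_basis I
  -- Deleting `N` costs only a null set and leaves a set that is non-null wherever it is met.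
  set N : Set I := ⋃ j ∈ {j | volume (K ∩ b j) = 0}, b j with hN
  have hNo : IsOpen N := isOpen_biUnion fun j _ => hbo j
  have hKN : volume (K ∩ N) = 0 := by
    rw [hN, Set.inter_iUnion₂]
    exact (measure_biUnion_null_iff (Set.to_countable _)).2 fun j hj => hj
  have hdiff : ∀ V, volume (K \ N ∩ V) = volume (K ∩ V) := by
    intro V
    refine le_antisymm (measure_mono (Set.inter_subset_inter_left _ Set.sdiff_subset)) ?_
    calc volume (K ∩ V) ≤ volume (K \ N ∩ V ∪ K ∩ N) := measure_mono fun r hr => by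
          by_cases h : r ∈ N
          · exact Or.inr ⟨hr.1, h⟩
          · exact Or.inl ⟨⟨hr.1, h⟩, hr.2⟩
      _ ≤ volume (K \ N ∩ V) + volume (K ∩ N) := measure_union_le _ _
      _ = volume (K \ N ∩ V) := by rw [hKN, add_zero]
  refine ⟨K \ N, hKc.sdiff hNo, ?_, ?_, fun n k => ⟨O (n, k), hO _, fun r hr => ?_⟩,
    fun V hV hne => ?_⟩
  · refine nonempty_of_measure_ne_zero (μ := volume) ?_
    have := hdiff Set.univ
    rw [Set.inter_univ, Set.inter_univ] at this
    rwa [this]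
  · exact Set.disjoint_left.2 fun r hr hrZ => hr.1 (Or.inl (hZU hrZ))
  · refine ⟨fun h => ?_, fun h => hWO (n, k) h⟩
    by_contra hr'
    exact hr.1 (Or.inr (Set.mem_iUnion.2 ⟨(n, k), hOU _ ⟨h, hr'⟩⟩))
  · obtain ⟨r, hr, hrV⟩ := hne
    obtain ⟨j, hj, hjV⟩ := hb V hV r hrV
    rw [hdiff]
    refine pos_iff_ne_zero.2 fun h => hr.2 (Set.mem_biUnion (x := j) ?_ hj)
    exact measure_mono_null (Set.inter_subset_inter_right _ hjV) h

/-- A set of positive measure is disjoint from few of the independent sets. -/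
theorem eventually_encard_disjoint_le {W : ℕ → ℕ → Set I}
    (hW : ∀ n (S : Finset ℕ),
      volume (⋂ k ∈ S, (W n k)ᶜ) = ENNReal.ofReal (1 - (1 / 2) ^ n) ^ S.card)
    {L : Set I} (hL : 0 < volume L) :
    ∀ᶠ n : ℕ in atTop, {k | Disjoint L (W n k)}.encard ≤ (n * 2 ^ n : ℕ) := by
  have hlim : Tendsto (fun n : ℕ => ENNReal.ofReal (Real.exp (-n))) atTop (nhds 0) := by
    rw [← ENNReal.ofReal_zero]
    exact ENNReal.tendsto_ofReal
      (Real.tendsto_exp_neg_atTop_nhds_zero.comp tendsto_natCast_atTop_atTop)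
  filter_upwards [hlim.eventually (gt_mem_nhds hL)] with n hn
  by_contra hcon
  obtain ⟨t, ht, htc⟩ := Set.exists_subset_encard_eq (not_le.1 hcon).le
  have htf : t.Finite := Set.finite_of_encard_eq_coe htc
  rw [htf.encard_eq_coe_toFinset_card] at htc
  have hcard : htf.toFinset.card = n * 2 ^ n := Nat.cast_injective htc
  refine absurd hn (not_lt.2 ?_)
  have hnn : (0 : ℝ) ≤ 1 - (1 / 2) ^ n :=
    sub_nonneg.2 (pow_le_one₀ (by norm_num) (by norm_num))
  calc volume L ≤ volume (⋂ k ∈ htf.toFinset, (W n k)ᶜ) := measure_mono fun r hr => by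
        simp only [Set.mem_iInter, Set.Finite.mem_toFinset]
        exact fun k hk h => Set.disjoint_left.1 (ht hk) hr h
    _ = ENNReal.ofReal ((1 - (1 / 2) ^ n) ^ (n * 2 ^ n)) := by
        rw [hW, hcard, ENNReal.ofReal_pow hnn]
    _ ≤ ENNReal.ofReal (Real.exp (-n)) := by
        refine ENNReal.ofReal_le_ofReal ?_
        calc (1 - (1 / 2 : ℝ) ^ n) ^ (n * 2 ^ n) ≤ Real.exp (-(1 / 2) ^ n) ^ (n * 2 ^ n) :=
              pow_le_pow_left₀ hnn (Real.one_sub_le_exp_neg _) _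
          _ = Real.exp (-n) := by
              rw [← Real.exp_nat_mul]
              congr 1
              push_cast
              rw [mul_neg, mul_assoc, ← mul_pow]
              norm_num

/-- Send `x` to the null limsup of the sets `W n (x n)`. If `B` contains it, every point of the
closed set `K B` avoiding `B` is in only finitely many of them. By Baire category, a non-null
portion `K B ∩ b j` misses `W n (x n)` for all large `n`, and few `k` are candidates for such an `x
n`. -/
theorem Lc_Fin_tukeyLE_null : (Lc Fin fun n => ∑ _j ∈ Finset.range (n + 1), n * 2 ^ n).TukeyLE
    (inclusionSystem null null_nonempty) := by
  classical
  obtain ⟨W, hWm, hWv, hWi⟩ := exists_independent_sets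
  obtain ⟨b, hbo, hb⟩ := exists_nat_basis I
  have hnull : ∀ B : null, volume (Subtype.val ⁻¹' (B : Set ℝ) : Set I) = 0 := fun B => by
    rw [unitInterval.volume_apply]
    exact measure_mono_null (Set.image_preimage_subset _ _) B.2
  choose K hKc hKne hKB hKW hKV using fun B : null => exists_isClosed_avoiding_null hWm (hnull B)
  let Q : null → ℕ → ℕ → Set ℕ := fun B j n => {k | Disjoint (K B ∩ b j) (W n k)}
  let Nx : (ℕ → ℕ) → Set I := fun x => {r | ∃ᶠ n in atTop, r ∈ W n (x n)}
  have hNx : ∀ x, volume (Nx x) = 0 := by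
    refine fun x => measure_setOfPred_frequently_eq_zero ?_
    have : ∑' n, volume (W n (x n)) = ∑' n, ENNReal.ofReal ((1 / 2) ^ n) :=
      tsum_congr fun n => hWv n (x n)
    change ∑' n, volume (W n (x n)) ≠ ∞
    rw [this]
    exact summable_geometric_two.tsum_ofReal_ne_top
  -- The index `j` produced by Baire category depends on `x`, so the slalom gathers the candidates
  -- for all `j ≤ n`, dropping those `Q B j n` that are too large.
  refine ⟨fun x => ⟨Subtype.val '' Nx x, ?_⟩, fun B => ⟨fun n => ⋃ j ∈ Finset.range (n + 1),
    if (Q B j n).encard ≤ (n * 2 ^ n : ℕ) then Q B j n else ∅, fun n => ?_⟩, fun x B hxB => ?_⟩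
  · exact (unitInterval.volume_apply).symm.trans (hNx x)
  · refine (Finset.set_encard_biUnion_le _ _).trans ?_
    rw [Nat.cast_sum]
    refine Finset.sum_le_sum fun j _ => ?_
    split_ifs with h
    · exact h
    · simp
  · have hcomp : CompactSpace (K B) := isCompact_iff_compactSpace.1 (hKc B).isCompact
    have hne : Nonempty (K B) := (hKne B).to_subtype
    let E : ℕ → Set (K B) := fun m => {r | ∀ n ≥ m, (r : I) ∉ W n (x n)}
    have hEc : ∀ m, IsClosed (E m) := by
      intro m
      have : E m = ⋂ n ≥ m, {r : K B | (r : I) ∉ W n (x n)} := by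
        ext r; simp [E]
      rw [this]
      refine isClosed_biInter fun n _ => ?_
      obtain ⟨O, hO, hOW⟩ := hKW B n (x n)
      have : {r : K B | (r : I) ∉ W n (x n)} = (Subtype.val ⁻¹' O)ᶜ := by
        ext r
        exact not_congr (hOW r r.2).symm
      rw [this]
      exact (hO.preimage continuous_subtype_val).isClosed_compl
    have hEu : ⋃ m, E m = Set.univ := by
      refine Set.eq_univ_of_forall fun r => ?_
      have hr : ¬ ∃ᶠ n in atTop, (r : I) ∈ W n (x n) := fun h =>
        Set.disjoint_left.1 (hKB B) r.2 (hxB ⟨r, h, rfl⟩)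
      obtain ⟨m, hm⟩ := eventually_atTop.1 (not_frequently.1 hr)
      exact Set.mem_iUnion.2 ⟨m, hm⟩
    obtain ⟨m, r, hr⟩ := nonempty_interior_of_iUnion_of_closed hEc hEu
    obtain ⟨V, hV, hVE⟩ := isOpen_induced_iff.1 (isOpen_interior (s := E m))
    rw [← hVE] at hr
    obtain ⟨j, hrj, hjV⟩ := hb V hV r hr
    have hpos := hKV B (b j) (hbo j) ⟨r, r.2, hrj⟩
    refine mem_dualFilter_Fin.2 ?_
    filter_upwards [eventually_encard_disjoint_le hWi hpos, eventually_ge_atTop m,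
      eventually_ge_atTop j] with n hn hmn hjn
    refine Set.mem_biUnion (x := j)
      (Finset.mem_coe.2 (Finset.mem_range.2 (Nat.lt_succ_of_le hjn))) ?_
    rw [if_pos hn]
    refine Set.disjoint_left.2 fun q hq hqW => ?_
    have hqE : (⟨q, hq.1⟩ : K B) ∈ E m := interior_subset (hVE ▸ hjV hq.2)
    exact hqE n hmn hqW

/-- Localization modulo an ideal with the Baire property. -/
theorem IsIdealOn.Lc_tukeyEquiv_null {J : Set (Set ℕ)} (hJ : IsIdealOn J)
    (hB : HasBaireProperty J) {g : ℕ → ℕ} (hg : Tendsto g atTop atTop) :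
    (Lc J g).TukeyEquiv (inclusionSystem null null_nonempty) := by
  obtain ⟨g', hg'⟩ := hJ.exists_Lc_Fin_tukeyLE hB g
  exact ⟨((hJ.Lc_tukeyLE_Fin g).trans (Lc_Fin_tukeyLE_of_tendsto hg _)).trans Lc_Fin_tukeyLE_null,
    (null_tukeyLE_Lc_Fin g').trans hg'⟩

end Slalom

theorem mainTheorem4 (J : Set (Set ℕ)) (hJ : Slalom.IsIdealOn J)
    (hBaire : Slalom.HasBaireProperty J) (h g : ℕ → ℕ)
    (hh : ∀ᶠ n in Filter.atTop, 1 ≤ h n) (hg : Filter.Tendsto g Filter.atTop Filter.atTop) :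
    (Slalom.pLc J h).TukeyEquiv (Slalom.pLc Slalom.Fin (fun _ => 1)) ∧
    (Slalom.Lc J g).TukeyEquiv (Slalom.inclusionSystem Slalom.null Slalom.null_nonempty) ∧
    Slalom.slE h J = Slalom.non Slalom.meager ∧
    Slalom.slT g J = Slalom.cof Slalom.null ∧
    Slalom.slTPerp g J = Slalom.add Slalom.null ∧
    Slalom.slEPerp h J = Slalom.cov Slalom.meager := by
  have h1 := hJ.pLc_tukeyEquiv hBaire hh
  have h2 := hJ.Lc_tukeyEquiv_null hBaire hg
  exact ⟨h1, h2, h1.dominatingNumber_eq.trans Slalom.dominatingNumber_pLc_Fin_one,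
    h2.dominatingNumber_eq.trans (Slalom.dominatingNumber_inclusionSystem _ _),
    h2.unboundingNumber_eq.trans (Slalom.unboundingNumber_inclusionSystem _ _
      fun _ _ hab hb => measure_mono_null hab hb),
    h1.unboundingNumber_eq.trans Slalom.unboundingNumber_pLc_Fin_one⟩
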